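/- **Theorem 2.** Let $n\ge 2$, let $\mathcal U\subset\mathbb R^n$ be open and connected, and let $F:\mathcal U\to\mathcal U$ be a ($C^1$) diffeomorphism of $\mathcal U$ onto itself. Suppose that $F$ has $n-1$ functionally independent first integrals $V_1,\dots,V_{n-1}:\mathcal U\to\mathbb R$ of class $C^2$, i.e. each $V_i$ is non-constant, $V_i\circ F=V_i$ on $\mathcal U$, and the Jacobian matrix of $V=(V_1,\dots,V_{n-1})$ has rank $n-1$ at almost every point of $\mathcal U$. Suppose also that $F$ satisfies condition $\mu$: there is a $C^1$ function $\mu:\mathcal U\to\mathbb R$ with $\mu(F(x))=\det(DF(x))\,\mu(x)$ for all $x\in\mathcal U$. Define the vector field $$X_\mu=\mu\cdot\Big(-\frac{\partial V_1}{\partial x_2},\frac{\partial V_1}{\partial x_1}\Big)\ \text{ if } n=2,\qquad X_\mu=\mu\cdot(\nabla V_1\times\cdots\times\nabla V_{n-1})\ \text{ if } n>2,$$ where $W_1\times\cdots\times W_{n-1}$ is the vector $W$ with $U\cdot W=\det(U,W_1,\dots,W_{n-1})$ for all $U\in\mathbb R^n$. For $p\in\mathcal U$ let $\varphi(t,p)$,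 $t\in I_p$, be the maximal solution in $\mathcal U$ of $\dot x=X_\mu(x)$ with $\varphi(0,p)=p$, and let $\gamma_p=\{\varphi(t,p): t\in I_p\}$ be its orbit. Let $\gamma_p$ be a regular orbit, in the sense that the connected component of $\{x\in\mathcal U: V(x)=V(p)\}$ that contains $p$ contains no zero of $X_\mu$, and suppose that $\{x\in\mathcal U: V(x)=V(p)\}$ has a finite number $M$ of connected components. Then there is an integer $m$ with $1\le m\le M$ such that $F^m(\gamma_p)=\gamma_p$, and the dynamics of $F^m$ restricted to $\gamma_p$ is translation-like, that is, one of the following holds: * $\gamma_p$ is a periodic orbit, with minimal period $T$, and $F^m|_{\gamma_p}$ is conjugated, by a $C^1$ diffeomorphism between the circle and $\gamma_p$, to the rotation of the circle with rotation number $\tau/T$, where $\varphi(\tau,p)=F^m(p)$; * $\gamma_p$ is diffeomorphic to the real line and $F^m|_{\gamma_p}$ is conjugated, by a $C^1$ diffeomorphism between the line and $\gamma_p$, to a translation of the line. -/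

import Mathlib

open Set MeasureTheory
open scoped Gradient

noncomputable section

/-- The Euclidean space `ℝⁿ`. -/
abbrev Euc (n : ℕ) : Type := EuclideanSpace ℝ (Fin n)

/-- The cross product of `k` vectors in `ℝ^(k+1)`: its `i`-th coordinate is `(-1)^i` times the
minor of the matrix with rows `W₁, …, W_k` obtained by deleting the `i`-th column
(coordinates are numbered from `0`). -/
def genCross {k : ℕ} (W : Fin k → Euc (k + 1)) : Euc (k + 1) :=
  WithLp.toLp 2 fun i =>
    (-1 : ℝ) ^ (i : ℕ) * (Matrix.of fun a b => W a (i.succAbove b)).det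

/-- The defining property of the cross product: `U · (W₁ × ⋯ × W_k) = det (U, W₁, …, W_k)`. -/
theorem sum_mul_genCross {k : ℕ} (W : Fin k → Euc (k + 1)) (U : Euc (k + 1)) :
    ∑ i, U i * genCross W i =
      (Matrix.of (Fin.cons (fun j => U j) (fun a j => W a j) :
        Fin (k + 1) → Fin (k + 1) → ℝ)).det := by
  rw [Matrix.det_succ_row_zero]
  refine Finset.sum_congr rfl fun i _ => ?_
  have h : (Matrix.of (Fin.cons (fun j => U j) (fun a j => W a j) :
      Fin (k + 1) → Fin (k + 1) → ℝ)).submatrix Fin.succ i.succAbove =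
      Matrix.of fun a b => W a (i.succAbove b) := by
    ext a b
    simp
  rw [h]
  simp only [genCross, Matrix.of_apply, Fin.cons_zero]
  ring

/-- The field `∇V₁ × ⋯ × ∇V_k` on `ℝ^(k+1)`; for a single function on the plane it is the
gradient rotated by a quarter turn, `(-∂V/∂x₂, ∂V/∂x₁)`. -/
def crossGrad : {k : ℕ} → (Fin k → Euc (k + 1) → ℝ) → Euc (k + 1) → Euc (k + 1)
  | 1, V, x => WithLp.toLp 2 ![-(∇ (V 0) x 1), ∇ (V 0) x 0]
  | _, V, x => genCross fun i => ∇ (V i) x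

/-- The vector field `X_μ = μ · (∇V₁ × ⋯ × ∇V_k)`. -/
def fieldMu {k : ℕ} (V : Fin k → Euc (k + 1) → ℝ) (μ : Euc (k + 1) → ℝ) (x : Euc (k + 1)) :
    Euc (k + 1) :=
  μ x • crossGrad V x

/-- `F` restricts to a (`C¹`) diffeomorphism of `U` onto itself. -/
def IsDiffeoOn {n : ℕ} (F : Euc n → Euc n) (U : Set (Euc n)) : Prop :=
  MapsTo F U U ∧ ContDiffOn ℝ 1 F U ∧
    ∃ G : Euc n → Euc n, MapsTo G U U ∧ ContDiffOn ℝ 1 G U ∧ InvOn G F U U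

/-- `v` is a first integral of the dynamical system generated by `F` on `U`: a non-constant
function that is constant along the orbits of `F`. -/
def IsFirstIntegral {n : ℕ} (F : Euc n → Euc n) (U : Set (Euc n)) (v : Euc n → ℝ) : Prop :=
  (∀ x ∈ U, v (F x) = v x) ∧ ∃ x ∈ U, ∃ y ∈ U, v x ≠ v y

/-- The functions `V₁, …, V_k` are functionally independent on `U`: the Jacobian matrix of
`(V₁, …, V_k)` has rank `k` at almost every point of `U`. -/
def FunctionallyIndependent {n k : ℕ} (V : Fin k → Euc n → ℝ) (U : Set (Euc n)) : Prop :=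
  ∀ᵐ x ∂(volume.restrict U), (Matrix.of fun (i : Fin k) (j : Fin n) => ∇ (V i) x j).rank = k

/-- Condition `μ`: `μ (F x) = det (DF x) · μ x` on `U`. -/
def ConditionMu {n : ℕ} (F : Euc n → Euc n) (U : Set (Euc n)) (μ : Euc n → ℝ) : Prop :=
  ∀ x ∈ U, μ (F x) = (fderiv ℝ F x).det * μ x

/-- The level set through `p`, `{x ∈ U | V x = V p}`. -/
def levelSet {n k : ℕ} (U : Set (Euc n)) (V : Fin k → Euc n → ℝ) (p : Euc n) : Set (Euc n) :=
  {x | x ∈ U ∧ ∀ i, V i x = V i p}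

/-- `φ` is a solution in `U`, on the open interval `I ∋ 0`, of `ẋ = X(x)`, `x(0) = p`. -/
structure IsSolution {n : ℕ} (X : Euc n → Euc n) (U : Set (Euc n)) (p : Euc n)
    (I : Set ℝ) (φ : ℝ → Euc n) : Prop where
  isOpen : IsOpen I
  ordConnected : I.OrdConnected
  zero_mem : (0 : ℝ) ∈ I
  init : φ 0 = p
  mapsTo : MapsTo φ I U
  hasDerivAt : ∀ t ∈ I, HasDerivAt φ (X (φ t)) t

/-- `φ` is the solution in `U` of `ẋ = X(x)`, `x(0) = p`, and `I` is its maximal interval of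
definition. The orbit of `p` is then `φ '' I`. -/
def IsMaximalSolution {n : ℕ} (X : Euc n → Euc n) (U : Set (Euc n)) (p : Euc n)
    (I : Set ℝ) (φ : ℝ → Euc n) : Prop :=
  IsSolution X U p I φ ∧ ∀ J ψ, IsSolution X U p J ψ → J ⊆ I

/-- `f` restricted to the curve `γ` is conjugated, through a diffeomorphism `H` of the unit circle
onto `γ` (a homeomorphism that is a `C¹` immersion), to the rotation of angle `θ`. -/
def ConjugatedToRotation {n : ℕ} (f : Euc n → Euc n) (γ : Set (Euc n)) (θ : ℝ) : Prop :=
  ∃ H : Circle ≃ₜ γ,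
    ContDiff ℝ 1 (fun t : ℝ => (H (Circle.exp t) : Euc n)) ∧
    (∀ t : ℝ, deriv (fun s : ℝ => (H (Circle.exp s) : Euc n)) t ≠ 0) ∧
    ∀ z : Circle, f (H z) = H (Circle.exp θ * z)

/-- `f` restricted to the curve `γ` is conjugated, through a diffeomorphism `H` of the real line
onto `γ` (a homeomorphism that is a `C¹` immersion), to the translation by `c`. -/
def ConjugatedToTranslation {n : ℕ} (f : Euc n → Euc n) (γ : Set (Euc n)) (c : ℝ) : Prop :=
  ∃ H : ℝ ≃ₜ γ,
    ContDiff ℝ 1 (fun t : ℝ => (H t : Euc n)) ∧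
    (∀ t : ℝ, deriv (fun s : ℝ => (H s : Euc n)) t ≠ 0) ∧
    ∀ t : ℝ, f (H t) = H (t + c)

/-- The dynamics of `f` on the orbit `γ = φ '' I` is translation-like. Either `γ` is a periodic
orbit, of minimal period `T`, and `f` on `γ` is conjugated to the rotation of the circle with
rotation number `τ / T`, where `φ(τ) = f(φ(0))`; or `γ` is diffeomorphic to the real line and `f`
on `γ` is conjugated to a translation of the line. -/
def TranslationLike {n : ℕ} (f : Euc n → Euc n) (I : Set ℝ) (φ : ℝ → Euc n) : Prop :=
  (∃ T τ : ℝ, I = univ ∧ IsLeast {S : ℝ | 0 < S ∧ Function.Periodic φ S} T ∧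
      φ τ = f (φ 0) ∧ ConjugatedToRotation f (φ '' I) (2 * Real.pi * (τ / T))) ∨
    ∃ c : ℝ, ConjugatedToTranslation f (φ '' I) c

end

/-!
The field `X_μ` is tangent to the level sets of `V = (V₁, …, V_k)` and is invariant under `F`:
the cross product of the gradients satisfies `DF · (∇V₁ × ⋯ × ∇V_k) = det DF · (∇V₁ × ⋯ × ∇V_k) ∘ F`
because `V ∘ F = V`, and condition `μ` absorbs the determinant (`fderiv_apply_fieldMu`). So `F`
sends solutions of `ẋ = X_μ(x)` to solutions.

At a point where `X_μ` does not vanish, `DV` has rank `k` and `X_μ` spans its kernel, so that by the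
inverse function theorem the level set is locally an arc of an orbit
(`IsCurve.image_mem_nhdsWithin_levelSet`). By connectedness a regular orbit is a whole connected
component of its level set (`IsMaximalSolution.image_eq_connectedComponentIn`). The homeomorphism
`F` of the level set permutes its `M` components, and a point of a set with `M` elements returns to
itself under a permutation after `m ≤ M` steps
(`exists_iterate_image_connectedComponentIn`). This gives `F^m(γ) = γ`.

As `F^m` commutes with the flow, `F^m(φ(t)) = φ(t + τ)` for all `t`, where `φ(τ) = F^m(φ(0))`
(`IsMaximalSolution.translationLike`). If `φ` is not injective, it is periodic and factors through
the circle. If it is injective, it is a diffeomorphism of its domain `I` onto the orbit, because the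
local arcs are open in the level set, and `I` is invariant under the shift by `τ`. Either `I` is the
whole line, or `τ = 0` and any diffeomorphism between the line and `I` serves.
-/

open Filter Topology

/-! ### Algebra of the cross product -/

/-- Transformation law of the cross product: multiplying the factors by `Bᵀ` multiplies the product
by the adjugate of `B`. It is stated after multiplication by `B`, so that `B` need not be
invertible. -/
theorem genCross_vecMul {k : ℕ} (B : Matrix (Fin (k + 1)) (Fin (k + 1)) ℝ)
    (W W' : Fin k → Euc (k + 1)) (h : ∀ a j, W' a j = ∑ i, W a i * B i j) (i : Fin (k + 1)) :
    ∑ j, B i j * genCross W' j = B.det * genCross W i := by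
  have h1 := sum_mul_genCross W' (WithLp.toLp 2 (B i))
  have h2 := sum_mul_genCross W (EuclideanSpace.single i 1)
  have h3 : (Matrix.of (Fin.cons (fun j => (WithLp.toLp 2 (B i) : Euc (k + 1)) j)
      (fun a j => W' a j) : Fin (k + 1) → Fin (k + 1) → ℝ)) =
      (Matrix.of (Fin.cons (fun j => (EuclideanSpace.single i 1 : Euc (k + 1)) j)
        (fun a j => W a j) : Fin (k + 1) → Fin (k + 1) → ℝ)) * B := by
    ext a j
    refine Fin.cases ?_ (fun a => ?_) a
    · simp [Matrix.mul_apply]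
    · simp [Matrix.mul_apply, h]
  rw [h3, Matrix.det_mul, ← h2] at h1
  simpa [mul_comm] using h1

theorem sum_mul_genCross_self {k : ℕ} (W : Fin k → Euc (k + 1)) (a : Fin k) :
    ∑ i, W a i * genCross W i = 0 := by
  rw [sum_mul_genCross]
  refine Matrix.det_zero_of_row_eq (i := 0) (j := a.succ) (Fin.succ_ne_zero a).symm ?_
  ext j
  simp

/-- If the cross product is nonzero, then together with its factors it spans the whole space. -/
theorem eq_zero_of_orthogonal_genCross {k : ℕ} (W : Fin k → Euc (k + 1)) (hW : genCross W ≠ 0)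
    (v : Euc (k + 1)) (h0 : ∑ i, genCross W i * v i = 0) (h : ∀ a, ∑ i, W a i * v i = 0) :
    v = 0 := by
  have hdet := sum_mul_genCross W (genCross W)
  have hne : ∑ i, genCross W i * genCross W i ≠ 0 := by
    contrapose! hW
    rw [Finset.sum_eq_zero_iff_of_nonneg fun i _ => mul_self_nonneg _] at hW
    ext i
    simpa using hW i (Finset.mem_univ i)
  rw [hdet] at hne
  have := Matrix.eq_zero_of_mulVec_eq_zero hne (v := fun i => v i) (by
    ext a
    refine Fin.cases ?_ (fun a => ?_) a
    · simpa [Matrix.mulVec, dotProduct] using h0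
    · simpa [Matrix.mulVec, dotProduct] using h a)
  ext i
  exact congrFun this i

/-- The two cases in the definition of `crossGrad` differ from the cross product of the gradients
only by a sign. -/
theorem exists_crossGrad_eq_smul_genCross (k : ℕ) : ∃ ε : ℝ, ε ≠ 0 ∧
    ∀ (V : Fin k → Euc (k + 1) → ℝ) (x : Euc (k + 1)),
      crossGrad V x = ε • genCross fun i => ∇ (V i) x := by
  match k with
  | 0 => exact ⟨1, one_ne_zero, fun V x => by simp [crossGrad]⟩
  | 1 =>
    refine ⟨-1, by norm_num, fun V x => ?_⟩
    ext i
    fin_cases i <;> simp [crossGrad, genCross, Fin.succAbove]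
  | k + 2 => exact ⟨1, one_ne_zero, fun V x => by simp [crossGrad]⟩

theorem fderiv_apply_eq_sum_gradient {n : ℕ} (f : Euc n → ℝ) (x v : Euc n) :
    fderiv ℝ f x v = ∑ i, ∇ f x i * v i := by
  have h : fderiv ℝ f x v = inner ℝ (∇ f x) v := by simp [gradient]
  rw [h, PiLp.inner_apply]
  simp [-inner_gradient_left, mul_comm]

/-! ### The vector field `X_μ` -/

theorem contDiffOn_gradient {n : ℕ} {f : Euc n → ℝ} {U : Set (Euc n)} (hU : IsOpen U)
    (hf : ContDiffOn ℝ 2 f U) : ContDiffOn ℝ 1 (∇ f) U :=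
  (InnerProductSpace.toDual ℝ (Euc n)).symm.contDiff.comp_contDiffOn
    (hf.fderiv_of_isOpen hU (by norm_num))

theorem contDiffOn_genCross {k : ℕ} {W : Fin k → Euc (k + 1) → Euc (k + 1)}
    {U : Set (Euc (k + 1))} (hW : ∀ a, ContDiffOn ℝ 1 (W a) U) :
    ContDiffOn ℝ 1 (fun x => genCross fun a => W a x) U := by
  rw [contDiffOn_euclidean]
  intro i
  simp only [genCross, Matrix.det_apply, Matrix.of_apply]
  refine contDiffOn_const.mul (ContDiffOn.sum fun σ _ => ContDiffOn.const_smul _ ?_)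
  exact contDiffOn_prod fun b _ => (contDiffOn_euclidean.1 (hW _)) _

theorem contDiffOn_fieldMu {k : ℕ} {V : Fin k → Euc (k + 1) → ℝ} {μ : Euc (k + 1) → ℝ}
    {U : Set (Euc (k + 1))} (hU : IsOpen U) (hV : ∀ i, ContDiffOn ℝ 2 (V i) U)
    (hμ : ContDiffOn ℝ 1 μ U) : ContDiffOn ℝ 1 (fieldMu V μ) U := by
  obtain ⟨ε, -, h⟩ := exists_crossGrad_eq_smul_genCross k
  have h1 : fieldMu V μ = fun x => μ x • ε • genCross fun i => ∇ (V i) x := by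
    ext1 x
    rw [fieldMu, h]
  rw [h1]
  exact hμ.smul ((contDiffOn_genCross fun a => contDiffOn_gradient hU (hV a)).const_smul ε)

/-- The functions `V i` are constant along the solutions of `X_μ`. -/
theorem fderiv_fieldMu_eq_zero {k : ℕ} {V : Fin k → Euc (k + 1) → ℝ} {μ : Euc (k + 1) → ℝ}
    {x : Euc (k + 1)} (i : Fin k) :
    fderiv ℝ (V i) x (fieldMu V μ x) = 0 := by
  obtain ⟨ε, -, h⟩ := exists_crossGrad_eq_smul_genCross k
  rw [fieldMu, h, map_smul, map_smul, fderiv_apply_eq_sum_gradient,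
    sum_mul_genCross_self (fun i => ∇ (V i) x) i]
  simp

/-- Away from its zeros, `X_μ` spans the orthogonal complement of the gradients of the `V i`. -/
theorem eq_zero_of_fderiv_eq_zero_of_inner_fieldMu {k : ℕ} {V : Fin k → Euc (k + 1) → ℝ}
    {μ : Euc (k + 1) → ℝ} {x : Euc (k + 1)} (hx : fieldMu V μ x ≠ 0)
    (v : Euc (k + 1)) (h : ∀ i, fderiv ℝ (V i) x v = 0)
    (h0 : inner ℝ (fieldMu V μ x) v = 0) : v = 0 := by
  obtain ⟨ε, -, hε⟩ := exists_crossGrad_eq_smul_genCross k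
  rw [fieldMu, hε] at hx h0
  rw [smul_ne_zero_iff, smul_ne_zero_iff] at hx
  refine eq_zero_of_orthogonal_genCross (fun i => ∇ (V i) x) hx.2.2 v ?_ fun a => ?_
  · rw [real_inner_smul_left, real_inner_smul_left] at h0
    have := (mul_eq_zero.1 ((mul_eq_zero.1 h0).resolve_left hx.1)).resolve_left hx.2.1
    simpa [PiLp.inner_apply, mul_comm] using this
  · rw [← fderiv_apply_eq_sum_gradient, h a]

/-- The field `X_μ` is invariant under `F`: the chain rule and the transformation law of the cross
product give `DF · (∇V₁ × ⋯ × ∇V_k) = det DF · (∇V₁ × ⋯ × ∇V_k) ∘ F`, and the factor `det DF` is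
absorbed by condition `μ`. -/
theorem fderiv_apply_fieldMu {k : ℕ} {V : Fin k → Euc (k + 1) → ℝ} {μ : Euc (k + 1) → ℝ}
    {U : Set (Euc (k + 1))} (hU : IsOpen U) {F : Euc (k + 1) → Euc (k + 1)} (hFU : MapsTo F U U)
    (hF : DifferentiableOn ℝ F U) (hV : ∀ i, DifferentiableOn ℝ (V i) U)
    (hVF : ∀ i, ∀ x ∈ U, V i (F x) = V i x) (hμ : ConditionMu F U μ)
    {x : Euc (k + 1)} (hx : x ∈ U) :
    fderiv ℝ F x (fieldMu V μ x) = fieldMu V μ (F x) := by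
  obtain ⟨ε, -, hε⟩ := exists_crossGrad_eq_smul_genCross k
  have hFx : DifferentiableAt ℝ F x := (hF x hx).differentiableAt (hU.mem_nhds hx)
  have hVFx : ∀ i, DifferentiableAt ℝ (V i) (F x) :=
    fun i => (hV i _ (hFU hx)).differentiableAt (hU.mem_nhds (hFU hx))
  set b := (EuclideanSpace.basisFun (Fin (k + 1)) ℝ).toBasis
  set B := LinearMap.toMatrix b b (fderiv ℝ F x : Euc (k + 1) →ₗ[ℝ] Euc (k + 1)) with hB
  have hBdet : B.det = (fderiv ℝ F x).det := LinearMap.det_toMatrix b _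
  have hBij : ∀ i j, B i j = fderiv ℝ F x (EuclideanSpace.single j 1) i := by
    intro i j
    simp [hB, b, LinearMap.toMatrix_apply]
  have hBv : ∀ v i, fderiv ℝ F x v i = ∑ j, B i j * v j := by
    intro v i
    have h := congrFun (LinearMap.toMatrix_mulVec_repr b b
      (fderiv ℝ F x : Euc (k + 1) →ₗ[ℝ] Euc (k + 1)) v) i
    simpa [Matrix.mulVec, dotProduct, b] using h.symm
  have hgrad : ∀ a j, ∇ (V a) x j = ∑ i, ∇ (V a) (F x) i * B i j := by
    intro a j
    have hloc : V a =ᶠ[nhds x] V a ∘ F := by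
      filter_upwards [hU.mem_nhds hx] with y hy using (hVF a y hy).symm
    have h1 : fderiv ℝ (V a) x = (fderiv ℝ (V a) (F x)).comp (fderiv ℝ F x) := by
      rw [hloc.fderiv_eq, fderiv_comp x (hVFx a) hFx]
    have h2 := congrArg (fun L => L (EuclideanSpace.single j 1)) h1
    simp only [ContinuousLinearMap.comp_apply] at h2
    rw [fderiv_apply_eq_sum_gradient, fderiv_apply_eq_sum_gradient] at h2
    simpa [hBij] using h2
  have hcross : fderiv ℝ F x (genCross fun i => ∇ (V i) x) =
      (fderiv ℝ F x).det • genCross fun i => ∇ (V i) (F x) := by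
    ext i
    rw [hBv, genCross_vecMul B _ _ hgrad, hBdet]
    simp
  rw [fieldMu, fieldMu, hε, hε, map_smul, map_smul, hcross, hμ x hx]
  simp only [smul_smul]
  congr 1
  ring

/-! ### Integral curves -/

/-- `ψ` is a solution in `U` of `ẋ = X(x)` on the open interval `J`, with no initial condition
prescribed (`J` may be empty). -/
structure IsCurve {n : ℕ} (X : Euc n → Euc n) (U : Set (Euc n)) (J : Set ℝ)
    (ψ : ℝ → Euc n) : Prop where
  isOpen : IsOpen J
  ordConnected : J.OrdConnected
  mapsTo : MapsTo ψ J U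
  hasDerivAt : ∀ t ∈ J, HasDerivAt ψ (X (ψ t)) t

section Curves

variable {n k : ℕ} {X : Euc n → Euc n} {U : Set (Euc n)} {J J' I : Set ℝ} {ψ χ φ : ℝ → Euc n}
  {p : Euc n}

theorem IsSolution.isCurve (h : IsSolution X U p J ψ) : IsCurve X U J ψ :=
  ⟨h.isOpen, h.ordConnected, h.mapsTo, h.hasDerivAt⟩

namespace IsCurve

theorem continuousAt (h : IsCurve X U J ψ) {t : ℝ} (ht : t ∈ J) : ContinuousAt ψ t :=
  (h.hasDerivAt t ht).continuousAt

theorem continuousOn (h : IsCurve X U J ψ) : ContinuousOn ψ J :=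
  fun _ ht => (h.continuousAt ht).continuousWithinAt

theorem isPreconnected (h : IsCurve X U J ψ) : IsPreconnected J :=
  h.ordConnected.isPreconnected

theorem comp_add (h : IsCurve X U J ψ) (c : ℝ) :
    IsCurve X U {t | t + c ∈ J} (fun t => ψ (t + c)) where
  isOpen := h.isOpen.preimage (continuous_add_const c)
  ordConnected := ⟨fun _ hx _ hy _ hz =>
    h.ordConnected.out hx hy ⟨by linarith [hz.1], by linarith [hz.2]⟩⟩
  mapsTo := fun _ ht => h.mapsTo ht
  hasDerivAt := fun t ht => (h.hasDerivAt (t + c) ht).comp_add_const t c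

theorem map {F : Euc n → Euc n} (h : IsCurve X U J ψ) (hU : IsOpen U) (hFU : MapsTo F U U)
    (hF : DifferentiableOn ℝ F U) (hFX : ∀ x ∈ U, fderiv ℝ F x (X x) = X (F x)) :
    IsCurve X U J (F ∘ ψ) where
  isOpen := h.isOpen
  ordConnected := h.ordConnected
  mapsTo := hFU.comp h.mapsTo
  hasDerivAt := fun t ht => by
    have hx := h.mapsTo ht
    have h1 := ((hF _ hx).differentiableAt (hU.mem_nhds hx)).hasFDerivAt.comp_hasDerivAt t
      (h.hasDerivAt t ht)
    rwa [hFX _ hx] at h1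

theorem map_iterate {F : Euc n → Euc n} (h : IsCurve X U J ψ) (hU : IsOpen U)
    (hFU : MapsTo F U U) (hF : DifferentiableOn ℝ F U)
    (hFX : ∀ x ∈ U, fderiv ℝ F x (X x) = X (F x)) (m : ℕ) : IsCurve X U J (F^[m] ∘ ψ) := by
  induction m with
  | zero => exact h
  | succ m ih =>
    rw [Function.iterate_succ']
    exact ih.map hU hFU hF hFX

theorem eqOn (h : IsCurve X U J ψ) (h' : IsCurve X U J' χ) (hU : IsOpen U)
    (hX : ContDiffOn ℝ 1 X U) {t₀ : ℝ} (ht : t₀ ∈ J) (ht' : t₀ ∈ J') (h0 : ψ t₀ = χ t₀) :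
    EqOn ψ χ (J ∩ J') := by
  -- Local uniqueness makes the set of coincidence times open, and by continuity it is closed.
  have hloc : ∀ t ∈ J ∩ J', ψ t = χ t → ψ =ᶠ[𝓝 t] χ := by
    rintro t ⟨htJ, htJ'⟩ heq
    have hx : U ∈ 𝓝 (ψ t) := hU.mem_nhds (h.mapsTo htJ)
    obtain ⟨K, s, hs, hK⟩ := (hX.contDiffAt hx).exists_lipschitzOnWith
    refine ODE_solution_unique_of_eventually (v := fun _ => X) (s := fun _ => s) (K := K)
      (Eventually.of_forall fun _ => hK) ?_ ?_ heq
    · filter_upwards [h.isOpen.mem_nhds htJ, h.continuousAt htJ hs] with u hu hus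
      exact ⟨h.hasDerivAt u hu, hus⟩
    · filter_upwards [h'.isOpen.mem_nhds htJ', h'.continuousAt htJ' (heq ▸ hs)] with u hu hus
      exact ⟨h'.hasDerivAt u hu, hus⟩
  have hconn : IsPreconnected (J ∩ J') := (h.ordConnected.inter h'.ordConnected).isPreconnected
  have hsub : J ∩ J' ⊆ {t | ψ =ᶠ[𝓝 t] χ} := by
    refine hconn.subset_of_closure_inter_subset isOpen_setOfPred_eventually_nhds
      ⟨t₀, ⟨ht, ht'⟩, hloc t₀ ⟨ht, ht'⟩ h0⟩ ?_
    rintro t ⟨htc, htJ⟩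
    refine hloc t htJ ?_
    have hfr : ∃ᶠ u in 𝓝 t, ψ u = χ u :=
      (mem_closure_iff_frequently.1 htc).mono fun u hu => hu.self_of_nhds
    exact tendsto_nhds_unique_of_frequently_eq (h.continuousAt htJ.1) (h'.continuousAt htJ.2) hfr
  exact fun t ht => (hsub ht).self_of_nhds

theorem apply_eq {v : Euc n → ℝ} (h : IsCurve X U J ψ) (hU : IsOpen U)
    (hv : DifferentiableOn ℝ v U) (hvX : ∀ x ∈ U, fderiv ℝ v x (X x) = 0) {s t : ℝ}
    (hs : s ∈ J) (ht : t ∈ J) : v (ψ s) = v (ψ t) := by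
  have hd : ∀ u ∈ J, HasDerivAt (v ∘ ψ) 0 u := fun u hu => by
    have hx := h.mapsTo hu
    have h1 := ((hv _ hx).differentiableAt (hU.mem_nhds hx)).hasFDerivAt.comp_hasDerivAt u
      (h.hasDerivAt u hu)
    rwa [hvX _ hx] at h1
  exact h.isOpen.is_const_of_deriv_eq_zero h.isPreconnected
    (fun u hu => (hd u hu).differentiableAt.differentiableWithinAt)
    (fun u hu => (hd u hu).deriv) hs ht

end IsCurve

/-- A solution that meets a maximal solution at some common time is a restriction of it. -/
theorem IsMaximalSolution.subset_and_eqOn (hφ : IsMaximalSolution X U p I φ) (hU : IsOpen U)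
    (hX : ContDiffOn ℝ 1 X U) (h : IsCurve X U J χ) {t₀ : ℝ} (ht : t₀ ∈ I) (ht' : t₀ ∈ J)
    (h0 : χ t₀ = φ t₀) : J ⊆ I ∧ EqOn χ φ J := by
  classical
  have hI := hφ.1.isCurve
  have heq : EqOn φ χ (I ∩ J) := hI.eqOn h hU hX ht ht' h0.symm
  have hJI : J ⊆ I := by
    have hωI : EqOn (I.piecewise φ χ) φ I := piecewise_eqOn I φ χ
    have hωJ : EqOn (I.piecewise φ χ) χ J := fun t htJ => by
      by_cases htI : t ∈ I
      · rw [hωI htI, heq ⟨htI, htJ⟩]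
      · exact piecewise_eqOn_compl I φ χ htI
    have hsol : IsSolution X U p (I ∪ J) (I.piecewise φ χ) :=
      { isOpen := hI.isOpen.union h.isOpen
        ordConnected := (IsPreconnected.union t₀ ht ht' hI.isPreconnected
          h.isPreconnected).ordConnected
        zero_mem := Or.inl hφ.1.zero_mem
        init := by rw [hωI hφ.1.zero_mem, hφ.1.init]
        mapsTo := by
          rintro t (htI | htJ)
          · rw [hωI htI]; exact hI.mapsTo htI
          · rw [hωJ htJ]; exact h.mapsTo htJ
        hasDerivAt := by
          rintro t (htI | htJ)
          · rw [hωI htI]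
            exact (hI.hasDerivAt t htI).congr_of_eventuallyEq
              (hωI.eventuallyEq_of_mem (hI.isOpen.mem_nhds htI))
          · rw [hωJ htJ]
            exact (h.hasDerivAt t htJ).congr_of_eventuallyEq
              (hωJ.eventuallyEq_of_mem (h.isOpen.mem_nhds htJ)) }
    exact subset_union_right.trans (hφ.2 _ _ hsol)
  exact ⟨hJI, fun t htJ => (heq ⟨hJI htJ, htJ⟩).symm⟩

/-- A solution `χ` that at time `t` is where a maximal solution `φ` is at time `s` is a restriction
of `φ`, up to the time shift `s - t`. -/
theorem IsMaximalSolution.add_mem_and_apply_add (hφ : IsMaximalSolution X U p I φ) (hU : IsOpen U)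
    (hX : ContDiffOn ℝ 1 X U) (h : IsCurve X U J χ) {s t : ℝ} (hs : s ∈ I) (ht : t ∈ J)
    (h0 : χ t = φ s) {u : ℝ} (hu : u ∈ J) : u + (s - t) ∈ I ∧ φ (u + (s - t)) = χ u := by
  have h1 := h.comp_add (t - s)
  obtain ⟨h2, h3⟩ := hφ.subset_and_eqOn hU hX h1 (t₀ := s) hs (by simpa using ht)
    (by simpa using h0)
  have hu' : u + (s - t) + (t - s) = u := by ring
  have hmem : u + (s - t) + (t - s) ∈ J := by rwa [hu']
  refine ⟨h2 hmem, ?_⟩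
  rw [← h3 hmem]
  exact congrArg χ hu'

/-! ### Level sets near a regular point -/

/-- A map whose strict derivative is injective is injective near the point. -/
theorem HasStrictFDerivAt.exists_injOn_of_ker_eq_bot {E G : Type*} [NormedAddCommGroup E]
    [NormedSpace ℝ E] [FiniteDimensional ℝ E] [NormedAddCommGroup G] [NormedSpace ℝ G]
    {f : E → G} {f' : E →L[ℝ] G} {a : E} (hf : HasStrictFDerivAt f f' a)
    (h : ∀ v, f' v = 0 → v = 0) : ∃ s ∈ 𝓝 a, InjOn f s := by
  obtain ⟨K, hK, hanti⟩ := (f' : E →ₗ[ℝ] G).exists_antilipschitzWith (LinearMap.ker_eq_bot'.2 h)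
  obtain ⟨s, hs, happ⟩ := hf.approximates_deriv_on_nhds (c := K⁻¹ / 2) (Or.inr (by positivity))
  refine ⟨s, hs, fun x hx y hy hxy => ?_⟩
  have h1 := happ x hx y hy
  have h2 := hanti.le_mul_dist x y
  have hK' : (0 : ℝ) < K := hK
  rw [hxy, sub_self, zero_sub, norm_neg] at h1
  rw [dist_eq_norm, dist_eq_norm, ContinuousLinearMap.coe_coe, ← map_sub] at h2
  rw [← sub_eq_zero, ← norm_le_zero_iff]
  have h3 : (K : ℝ) * ‖f' (x - y)‖ ≤ K * ((K : ℝ)⁻¹ / 2 * ‖x - y‖) := by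
    gcongr
    simpa using h1
  have h4 : (K : ℝ) * ((K : ℝ)⁻¹ / 2 * ‖x - y‖) = ‖x - y‖ / 2 := by field_simp
  linarith

theorem mem_levelSet_self {V : Fin k → Euc n → ℝ} (hp : p ∈ U) : p ∈ levelSet U V p :=
  ⟨hp, fun _ => rfl⟩

theorem levelSet_eq_of_mem {V : Fin k → Euc n → ℝ} {q : Euc n} (hq : q ∈ levelSet U V p) :
    levelSet U V q = levelSet U V p := by
  ext x
  simp only [levelSet, mem_ofPred_eq, hq.2]

theorem IsCurve.mem_levelSet (h : IsCurve X U J ψ) (hU : IsOpen U) {V : Fin k → Euc n → ℝ}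
    (hV : ∀ i, ContDiffOn ℝ 1 (V i) U) (hVX : ∀ x ∈ U, ∀ i, fderiv ℝ (V i) x (X x) = 0)
    {s t : ℝ} (hs : s ∈ J) (ht : t ∈ J) : ψ s ∈ levelSet U V (ψ t) :=
  ⟨h.mapsTo hs, fun i =>
    h.apply_eq hU ((hV i).differentiableOn one_ne_zero) (fun x hx => hVX x hx i) hs ht⟩

/-- Near a point `x₀` at which `X` does not vanish, the level set of `V` is an arc of the orbit:
`x ↦ (V x, ⟪X x₀, x⟫)` is injective near `x₀`, and the second coordinate of a solution through `x₀`
takes all values near `⟪X x₀, x₀⟫`. -/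
theorem IsCurve.image_mem_nhdsWithin_levelSet (h : IsCurve X U J ψ) (hU : IsOpen U)
    (hX : ContDiffOn ℝ 1 X U) {V : Fin k → Euc n → ℝ} (hV : ∀ i, ContDiffOn ℝ 1 (V i) U)
    (hVX : ∀ x ∈ U, ∀ i, fderiv ℝ (V i) x (X x) = 0)
    (hVker : ∀ x ∈ U, X x ≠ 0 → ∀ v, (∀ i, fderiv ℝ (V i) x v = 0) → inner ℝ (X x) v = 0 → v = 0)
    {t₀ : ℝ} (ht : t₀ ∈ J) (h0 : X (ψ t₀) ≠ 0) {N : Set ℝ} (hN : N ∈ 𝓝 t₀) :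
    ψ '' N ∈ 𝓝[levelSet U V (ψ t₀)] (ψ t₀) := by
  set x₀ := ψ t₀
  have hx₀ : x₀ ∈ U := h.mapsTo ht
  have hUx : U ∈ 𝓝 x₀ := hU.mem_nhds hx₀
  have hG : HasStrictFDerivAt (fun x => ((fun i => V i x), inner ℝ (X x₀) x))
      ((ContinuousLinearMap.pi fun i => fderiv ℝ (V i) x₀).prod (innerSL ℝ (X x₀))) x₀ := by
    refine HasStrictFDerivAt.prodMk (hasStrictFDerivAt_pi.2 fun i => ?_)
      (innerSL ℝ (X x₀)).hasStrictFDerivAt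
    exact ((hV i).contDiffAt hUx).hasStrictFDerivAt one_ne_zero
  obtain ⟨s, hs, hinj⟩ := hG.exists_injOn_of_ker_eq_bot fun v hv => by
    have hv' := Prod.mk_eq_zero.1 hv
    exact hVker x₀ hx₀ h0 v (fun i => congrFun hv'.1 i) hv'.2
  have hN' : N ∩ J ∩ ψ ⁻¹' s ∈ 𝓝 t₀ :=
    inter_mem (inter_mem hN (h.isOpen.mem_nhds ht)) (h.continuousAt ht hs)
  have hσ : HasStrictDerivAt (fun t => inner ℝ (X x₀) (ψ t)) (inner ℝ (X x₀) (X (ψ t₀))) t₀ := by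
    refine hasStrictDerivAt_of_hasDerivAt_of_continuousAt
      (f' := fun t => inner ℝ (X x₀) (X (ψ t))) ?_ ?_
    · filter_upwards [h.isOpen.mem_nhds ht] with t htJ
      exact (innerSL ℝ (X x₀)).hasFDerivAt.comp_hasDerivAt t (h.hasDerivAt t htJ)
    · exact continuousAt_const.inner
        (((hX.contDiffAt hUx).continuousAt).comp (h.continuousAt ht))
  have hσ0 : inner ℝ (X x₀) (X (ψ t₀)) ≠ (0 : ℝ) := inner_self_ne_zero.2 h0
  have himg : (fun t => inner ℝ (X x₀) (ψ t)) '' (N ∩ J ∩ ψ ⁻¹' s) ∈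
      𝓝 (inner ℝ (X x₀) x₀ : ℝ) := by
    rw [← hσ.map_nhds_eq hσ0]
    exact image_mem_map hN'
  have hpre := (innerSL ℝ (X x₀)).continuous.continuousAt.preimage_mem_nhds (x := x₀) himg
  filter_upwards [mem_nhdsWithin_of_mem_nhds hs, mem_nhdsWithin_of_mem_nhds hpre,
    self_mem_nhdsWithin] with y hys hyσ hyL
  obtain ⟨t, ⟨⟨htN, htJ⟩, hts⟩, hty⟩ := hyσ
  refine ⟨t, htN, hinj hts hys (Prod.ext (funext fun i => ?_) hty)⟩
  exact ((h.mem_levelSet hU hV hVX htJ ht).2 i).trans (hyL.2 i).symm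

/-- A regular orbit is a whole connected component of its level set. -/
theorem IsMaximalSolution.image_eq_connectedComponentIn (hφ : IsMaximalSolution X U p I φ)
    (hU : IsOpen U) (hX : ContDiffOn ℝ 1 X U) {V : Fin k → Euc n → ℝ}
    (hV : ∀ i, ContDiffOn ℝ 1 (V i) U) (hVX : ∀ x ∈ U, ∀ i, fderiv ℝ (V i) x (X x) = 0)
    (hVker : ∀ x ∈ U, X x ≠ 0 → ∀ v, (∀ i, fderiv ℝ (V i) x v = 0) → inner ℝ (X x) v = 0 → v = 0)
    (hreg : ∀ x ∈ connectedComponentIn (levelSet U V p) p, X x ≠ 0) :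
    φ '' I = connectedComponentIn (levelSet U V p) p := by
  have hI := hφ.1.isCurve
  have h0I := hφ.1.zero_mem
  have hsub : φ '' I ⊆ connectedComponentIn (levelSet U V p) p := by
    refine (hI.isPreconnected.image φ hI.continuousOn).subset_connectedComponentIn
      ⟨0, h0I, hφ.1.init⟩ ?_
    rintro _ ⟨t, ht, rfl⟩
    rw [← hφ.1.init]
    exact hI.mem_levelSet hU hV hVX ht h0I
  refine hsub.antisymm ?_
  set L := levelSet U V p
  set C := connectedComponentIn L p
  have hCL : C ⊆ L := connectedComponentIn_subset L p
  -- Around each point of the component the level set is an arc of a single orbit, so that being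
  -- on the orbit of `p` is a locally constant property on the component.
  have hloc : ∀ x ∈ C, ∀ᶠ y in 𝓝[C] x, y ∈ φ '' I ↔ x ∈ φ '' I := by
    intro x hx
    have hxU : x ∈ U := (hCL hx).1
    obtain ⟨ψ, hψ0, ε, hε, hψ⟩ := (hX.contDiffAt
      (hU.mem_nhds hxU)).exists_forall_mem_closedBall_exists_eq_forall_mem_Ioo_hasDerivAt₀ 0
    rw [zero_sub, zero_add] at hψ
    have hψc : ContinuousAt ψ 0 := (hψ 0 ⟨by linarith, hε⟩).continuousAt
    obtain ⟨δ, hδ, hδU⟩ := Metric.mem_nhds_iff.1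
      (hψc.preimage_mem_nhds (hψ0.symm ▸ hU.mem_nhds hxU))
    rw [Real.ball_eq_Ioo, zero_sub, zero_add] at hδU
    have hη : 0 < min ε δ := lt_min hε hδ
    have hJ : IsCurve X U (Ioo (-min ε δ) (min ε δ)) ψ :=
      { isOpen := isOpen_Ioo
        ordConnected := ordConnected_Ioo
        mapsTo := fun t ht => hδU ⟨by linarith [ht.1, min_le_right ε δ],
          ht.2.trans_le (min_le_right ε δ)⟩
        hasDerivAt := fun t ht => hψ t ⟨by linarith [ht.1, min_le_left ε δ],
          ht.2.trans_le (min_le_left ε δ)⟩ }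
    have h0 : (0 : ℝ) ∈ Ioo (-min ε δ) (min ε δ) := ⟨by linarith, hη⟩
    have harc := hJ.image_mem_nhdsWithin_levelSet hU hX hV hVX hVker h0
      (hψ0.symm ▸ hreg x hx) (isOpen_Ioo.mem_nhds h0)
    rw [hψ0, levelSet_eq_of_mem (hCL hx)] at harc
    filter_upwards [nhdsWithin_mono x hCL harc] with y hy
    obtain ⟨u, hu, rfl⟩ := hy
    have key : ∀ a ∈ Ioo (-min ε δ) (min ε δ), ∀ b ∈ Ioo (-min ε δ) (min ε δ),
        ψ a ∈ φ '' I → ψ b ∈ φ '' I := by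
      rintro a ha b hb ⟨s, hs, hsa⟩
      obtain ⟨h1, h2⟩ := hφ.add_mem_and_apply_add hU hX hJ hs ha hsa.symm hb
      exact ⟨_, h1, h2⟩
    rw [← hψ0]
    exact ⟨key u hu 0 h0, key 0 h0 u hu⟩
  have hCpre : IsPreconnected C := isPreconnected_connectedComponentIn
  have hpC : p ∈ C := hsub ⟨0, h0I, hφ.1.init⟩
  intro x hx
  exact (hCpre.induction₂ (fun x y => y ∈ φ '' I ↔ x ∈ φ '' I) hloc
    (fun _ _ _ _ _ _ h1 h2 => h2.trans h1) (fun _ _ _ _ h => h.symm) hpC hx).2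
    ⟨0, h0I, hφ.1.init⟩

end Curves

/-! ### Permutation of the connected components -/

/-- A homeomorphism of a space with finitely many components permutes them, and so some iterate,
whose order is at most the number of components, preserves a given one. -/
theorem Homeomorph.exists_iterate_image_connectedComponent {Y : Type*} [TopologicalSpace Y]
    [Finite (ConnectedComponents Y)] (f : Y ≃ₜ Y) (a : Y) :
    ∃ m : ℕ, 1 ≤ m ∧ m ≤ Nat.card (ConnectedComponents Y) ∧
      f^[m] '' connectedComponent a = connectedComponent a := by
  have : Fintype (ConnectedComponents Y) := Fintype.ofFinite _
  set g := f.continuous.connectedComponentsMap with hg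
  have hgf : ∀ y : Y, g (ConnectedComponents.mk y) = ConnectedComponents.mk (f y) := fun _ => rfl
  have hginj : Function.Injective g := by
    refine Function.LeftInverse.injective (g := f.symm.continuous.connectedComponentsMap) ?_
    intro y
    obtain ⟨y, rfl⟩ := ConnectedComponents.surjective_coe y
    change ConnectedComponents.mk (f.symm (f y)) = _
    rw [f.symm_apply_apply]
  set m := Function.minimalPeriod g (ConnectedComponents.mk a)
  have hm : 0 < m := Function.minimalPeriod_pos_of_mem_periodicPts (hginj.mem_periodicPts _)
  refine ⟨m, hm, ?_, ?_⟩
  · rw [Nat.card_eq_fintype_card]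
    exact Function.minimalPeriod_le_card
  have hper : g^[m] (ConnectedComponents.mk a) = ConnectedComponents.mk a :=
    Function.iterate_minimalPeriod
  have hsemi : Function.Semiconj (ConnectedComponents.mk : Y → ConnectedComponents Y) f g :=
    fun y => (hgf y).symm
  rw [← (hsemi.iterate_right m) a] at hper
  have hcc : connectedComponent (f^[m] a) = connectedComponent a :=
    ConnectedComponents.coe_eq_coe.1 hper
  have hleft : Function.LeftInverse f.symm^[m] f^[m] :=
    Function.LeftInverse.iterate f.symm_apply_apply m
  have hright : Function.LeftInverse f^[m] f.symm^[m] :=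
    Function.LeftInverse.iterate f.apply_symm_apply m
  refine Subset.antisymm ?_ ?_
  · exact ((f.continuous.iterate m).image_connectedComponent_subset a).trans hcc.subset
  · intro y hy
    refine ⟨f.symm^[m] y, ?_, hright y⟩
    have h1 := (f.symm.continuous.iterate m).image_connectedComponent_subset (f^[m] a)
    rw [hleft a, hcc] at h1
    exact h1 (mem_image_of_mem _ hy)

theorem exists_iterate_image_connectedComponentIn {n k : ℕ} {U : Set (Euc n)}
    {F : Euc n → Euc n} (hF : IsDiffeoOn F U) {V : Fin k → Euc n → ℝ}
    (hVF : ∀ i, ∀ x ∈ U, V i (F x) = V i x) {p : Euc n} (hp : p ∈ U)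
    [Finite (ConnectedComponents (levelSet U V p))] :
    ∃ m : ℕ, 1 ≤ m ∧ m ≤ Nat.card (ConnectedComponents (levelSet U V p)) ∧
      F^[m] '' connectedComponentIn (levelSet U V p) p =
        connectedComponentIn (levelSet U V p) p := by
  obtain ⟨hFU, hFs, G, hGU, hGs, hGF, hFG⟩ := hF
  have hFL : MapsTo F (levelSet U V p) (levelSet U V p) := fun x hx =>
    ⟨hFU hx.1, fun i => (hVF i x hx.1).trans (hx.2 i)⟩
  have hGL : MapsTo G (levelSet U V p) (levelSet U V p) := fun x hx =>
    ⟨hGU hx.1, fun i => by rw [← hVF i _ (hGU hx.1), hFG hx.1, hx.2 i]⟩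
  have hLU : levelSet U V p ⊆ U := fun x hx => hx.1
  let f : levelSet U V p ≃ₜ levelSet U V p :=
    { toFun := hFL.restrict
      invFun := hGL.restrict
      left_inv := fun x => Subtype.ext (hGF x.2.1)
      right_inv := fun x => Subtype.ext (hFG x.2.1)
      continuous_toFun := (hFs.continuousOn.mono hLU).mapsToRestrict hFL
      continuous_invFun := (hGs.continuousOn.mono hLU).mapsToRestrict hGL }
  obtain ⟨m, h1, h2, h3⟩ := f.exists_iterate_image_connectedComponent ⟨p, mem_levelSet_self hp⟩
  refine ⟨m, h1, h2, ?_⟩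
  have hsemi : Function.Semiconj (Subtype.val : levelSet U V p → Euc n) f F := fun _ => rfl
  rw [connectedComponentIn_eq_image (mem_levelSet_self hp), image_image]
  conv_rhs => rw [← h3, image_image]
  exact image_congr fun y _ => ((hsemi.iterate_right m) y).symm

/-! ### Open intervals of the line -/

theorem Set.OrdConnected.eq_univ_of_add_sub_mem {I : Set ℝ} (hI : I.OrdConnected)
    (h0 : (0 : ℝ) ∈ I) {d : ℝ} (hd : d ≠ 0) (hadd : ∀ u ∈ I, u + d ∈ I)
    (hsub : ∀ u ∈ I, u - d ∈ I) : I = univ := by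
  wlog hpos : 0 < d generalizing d
  · refine this (d := -d) (neg_ne_zero.2 hd) (fun u hu => ?_) (fun u hu => ?_)
      (neg_pos.2 (lt_of_le_of_ne (not_lt.1 hpos) hd))
    · simpa [sub_eq_add_neg] using hsub u hu
    · simpa using hadd u hu
  have hp : ∀ n : ℕ, (n : ℝ) * d ∈ I := fun n => by
    induction n with
    | zero => simpa using h0
    | succ n ih => simpa [add_mul] using hadd _ ih
  have hm : ∀ n : ℕ, -((n : ℝ) * d) ∈ I := fun n => by
    induction n with
    | zero => simpa using h0
    | succ n ih =>
      have := hsub _ ih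
      rwa [show -(((n + 1 : ℕ) : ℝ) * d) = -((n : ℝ) * d) - d by push_cast; ring]
  refine eq_univ_of_forall fun x => ?_
  obtain ⟨n, hn⟩ := exists_nat_ge (|x| / d)
  have hx := abs_le.1 ((div_le_iff₀ hpos).1 hn)
  exact hI.out (hm n) (hp n) ⟨hx.1, hx.2⟩

theorem IsOpen.eq_Ioo_or_of_ordConnected {I : Set ℝ} (ho : IsOpen I) (hI : I.OrdConnected) :
    (∃ a b, I = Ioo a b) ∨ (∃ a, I = Ioi a) ∨ (∃ b, I = Iio b) ∨ I = univ := by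
  have h := hI.isPreconnected.mem_intervals
  have hint := ho.interior_eq
  generalize sInf I = a, sSup I = b at h
  simp only [mem_insert_iff, mem_singleton_iff] at h
  rcases h with h | h | h | h | h | h | h | h | h | h <;> subst h <;>
    try simp only [interior_Icc, interior_Ico, interior_Ioc, interior_Ici, interior_Iic] at hint
  · exact Or.inl ⟨a, b, hint.symm⟩
  · exact Or.inl ⟨a, b, hint.symm⟩
  · exact Or.inl ⟨a, b, hint.symm⟩
  · exact Or.inl ⟨a, b, rfl⟩
  · exact Or.inr (Or.inl ⟨a, hint.symm⟩)
  · exact Or.inr (Or.inl ⟨a, rfl⟩)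
  · exact Or.inr (Or.inr (Or.inl ⟨b, hint.symm⟩))
  · exact Or.inr (Or.inr (Or.inl ⟨b, rfl⟩))
  · exact Or.inr (Or.inr (Or.inr rfl))
  · exact Or.inl ⟨0, 0, by simp⟩

/-- Every nonempty open interval is diffeomorphic to the line. -/
theorem exists_contDiff_range_eq {I : Set ℝ} (ho : IsOpen I) (hI : I.OrdConnected)
    (hne : I.Nonempty) : ∃ ρ : ℝ → ℝ, ContDiff ℝ 1 ρ ∧ (∀ t, deriv ρ t ≠ 0) ∧
      Function.Injective ρ ∧ range ρ = I := by
  rcases ho.eq_Ioo_or_of_ordConnected hI with ⟨a, b, rfl⟩ | ⟨a, rfl⟩ | ⟨b, rfl⟩ | rfl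
  · have hab : 0 < b - a := sub_pos.2 (nonempty_Ioo.1 hne)
    refine ⟨fun t => a + (b - a) * Real.sigmoid t, ?_, fun t => ?_, fun x y h => ?_, ?_⟩
    · exact contDiff_const.add (contDiff_const.mul (contDiff_sigmoid.of_le le_top))
    · have h := ((Real.hasDerivAt_sigmoid t).const_mul (b - a)).const_add a
      rw [h.deriv]
      have := Real.sigmoid_pos t
      have := sub_pos.2 (Real.sigmoid_lt_one t)
      positivity
    · simpa [hab.ne'] using h
    · have h1 : (fun t => a + (b - a) * Real.sigmoid t) =
          (fun s => a + s) ∘ (fun s => (b - a) * s) ∘ Real.sigmoid := rfl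
      rw [h1, range_comp, range_comp, Real.range_sigmoid, image_mul_left_Ioo hab,
        image_const_add_Ioo]
      simp
  · refine ⟨fun t => a + Real.exp t, contDiff_const.add Real.contDiff_exp, fun t => ?_,
      fun x y h => by simpa using h, ?_⟩
    · rw [((Real.hasDerivAt_exp t).const_add a).deriv]
      exact (Real.exp_pos t).ne'
    · have h1 : (fun t => a + Real.exp t) = (fun s => a + s) ∘ Real.exp := rfl
      rw [h1, range_comp, Real.range_exp, image_const_add_Ioi, add_zero]
  · refine ⟨fun t => b - Real.exp t, contDiff_const.sub Real.contDiff_exp, fun t => ?_,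
      fun x y h => by simpa using h, ?_⟩
    · rw [((Real.hasDerivAt_exp t).const_sub b).deriv]
      exact neg_ne_zero.2 (Real.exp_pos t).ne'
    · have h1 : (fun t => b - Real.exp t) = (fun s => b - s) ∘ Real.exp := rfl
      rw [h1, range_comp, Real.range_exp, image_const_sub_Ioi, sub_zero]
  · exact ⟨id, contDiff_id, fun t => by simp, Function.injective_id, range_id⟩

/-! ### Parametrizations of the orbit -/

section Orbit

variable {n k : ℕ} {X : Euc n → Euc n} {U : Set (Euc n)} {I : Set ℝ} {φ : ℝ → Euc n}
  {p : Euc n} {f : Euc n → Euc n}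

theorem IsCurve.contDiffOn {J : Set ℝ} {ψ : ℝ → Euc n} (h : IsCurve X U J ψ)
    (hX : ContDiffOn ℝ 1 X U) : ContDiffOn ℝ 1 ψ J := by
  have hd : EqOn (deriv ψ) (X ∘ ψ) J := fun t ht => (h.hasDerivAt t ht).deriv
  refine (contDiffOn_one_iff_derivWithin h.isOpen.uniqueDiffOn).2 ⟨fun t ht =>
    (h.hasDerivAt t ht).differentiableAt.differentiableWithinAt, ?_⟩
  rw [continuousOn_congr fun _ => derivWithin_of_isOpen h.isOpen]
  exact (hX.continuousOn.comp h.continuousOn h.mapsTo).congr hd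

/-- If a maximal solution is at the same point at times `a` and `b`, then its domain is closed under
the shift by `b - a`, which is a period. -/
theorem IsMaximalSolution.add_sub_mem_and_apply (hφ : IsMaximalSolution X U p I φ)
    (hU : IsOpen U) (hX : ContDiffOn ℝ 1 X U) {a b : ℝ} (ha : a ∈ I) (hb : b ∈ I)
    (hab : φ a = φ b) {u : ℝ} (hu : u ∈ I) : u + (b - a) ∈ I ∧ φ (u + (b - a)) = φ u :=
  hφ.add_mem_and_apply_add hU hX hφ.1.isCurve hb ha hab hu

/-- A solution that is not injective is defined on the whole line and periodic, and its periods are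
the multiples of the least positive one. -/
theorem IsMaximalSolution.exists_period_of_not_injOn (hφ : IsMaximalSolution X U p I φ)
    (hU : IsOpen U) (hX : ContDiffOn ℝ 1 X U) (h0 : X p ≠ 0) (hinj : ¬InjOn φ I) :
    I = univ ∧ ∃ T : ℝ, IsLeast {S : ℝ | 0 < S ∧ Function.Periodic φ S} T ∧
      ∀ a b, φ a = φ b → ∃ z : ℤ, b - a = z * T := by
  simp only [InjOn, not_forall] at hinj
  obtain ⟨a, ha, b, hb, hab, hne⟩ := hinj
  have huniv : I = univ := hφ.1.ordConnected.eq_univ_of_add_sub_mem hφ.1.zero_mem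
    (sub_ne_zero.2 (Ne.symm hne)) (fun u hu => (hφ.add_sub_mem_and_apply hU hX ha hb hab hu).1)
    (fun u hu => by
      have := (hφ.add_sub_mem_and_apply hU hX hb ha hab.symm hu).1
      rwa [← neg_sub, ← sub_eq_add_neg] at this)
  subst huniv
  refine ⟨rfl, ?_⟩
  have hper : ∀ a b, φ a = φ b → Function.Periodic φ (b - a) := fun a b hab u =>
    (hφ.add_sub_mem_and_apply hU hX (mem_univ a) (mem_univ b) hab (mem_univ u)).2
  let S : AddSubgroup ℝ :=
    { carrier := {c | Function.Periodic φ c}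
      zero_mem' := fun u => by simp
      add_mem' := fun h h' => h.add_period h'
      neg_mem' := fun h => h.neg }
  have hSne : b - a ∈ S := hper a b hab
  have hcont : Continuous φ := continuousOn_univ.1 hφ.1.isCurve.continuousOn
  obtain ⟨c, hc⟩ : ∃ c, S = AddSubgroup.closure {c} := by
    -- A continuous function with a dense group of periods is constant, and `X p` is its derivative.
    refine S.dense_or_cyclic.resolve_left fun hd => h0 ?_
    have hconst : φ = fun _ => p := hcont.ext_on hd continuous_const fun u hu => by
      have : φ (0 + u) = φ 0 := hu 0
      rwa [zero_add, hφ.1.init] at this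
    have h1 := hφ.1.hasDerivAt 0 (mem_univ 0)
    rw [hφ.1.init] at h1
    exact h1.unique (hconst ▸ hasDerivAt_const (0 : ℝ) p)
  have hmem : ∀ s, Function.Periodic φ s ↔ ∃ z : ℤ, z • c = s := fun s => by
    rw [← AddSubgroup.mem_closure_singleton, ← hc]
    rfl
  have hc0 : c ≠ 0 := by
    rintro rfl
    obtain ⟨z, hz⟩ := (hmem _).1 hSne
    rw [smul_zero] at hz
    exact hne (sub_eq_zero.1 hz.symm).symm
  have hmul : ∀ s, Function.Periodic φ s → ∃ z : ℤ, s = z * |c| := fun s hs => by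
    obtain ⟨z, rfl⟩ := (hmem s).1 hs
    rcases abs_choice c with h | h
    · exact ⟨z, by rw [h, zsmul_eq_mul]⟩
    · exact ⟨-z, by rw [h, zsmul_eq_mul]; push_cast; ring⟩
  refine ⟨|c|, ⟨⟨abs_pos.2 hc0, ?_⟩, ?_⟩, fun a b h => hmul _ (hper a b h)⟩
  · rcases abs_choice c with h | h <;> rw [h]
    · exact (hmem c).2 ⟨1, one_smul ℤ c⟩
    · exact (hmem (-c)).2 ⟨-1, neg_one_smul ℤ c⟩
  · rintro s ⟨hs, hsp⟩
    obtain ⟨z, rfl⟩ := hmul s hsp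
    have hz : 0 < z := by
      have := (pos_iff_pos_of_mul_pos hs).2 (abs_pos.2 hc0)
      exact_mod_cast this
    have : (1 : ℝ) ≤ z := by exact_mod_cast hz
    nlinarith [abs_pos.2 hc0]

theorem conjugatedToRotation_of_periodic (hφ : IsCurve X U univ φ) (hX : ContDiffOn ℝ 1 X U)
    (h0 : ∀ t, X (φ t) ≠ 0) {T τ : ℝ} (hT : 0 < T) (hper : Function.Periodic φ T)
    (hmul : ∀ a b, φ a = φ b → ∃ z : ℤ, b - a = z * T) (hf : ∀ t, f (φ t) = φ (t + τ)) :
    ConjugatedToRotation f (φ '' univ) (2 * Real.pi * (τ / T)) := by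
  have : Fact (0 < T) := ⟨hT⟩
  have hφs : ContDiff ℝ 1 φ := contDiffOn_univ.1 (hφ.contDiffOn hX)
  have hmaps : ∀ x, hper.lift x ∈ φ '' univ := fun x => by
    obtain ⟨t, rfl⟩ := QuotientAddGroup.mk_surjective x
    exact ⟨t, mem_univ t, rfl⟩
  let g : AddCircle T → φ '' univ := fun x => ⟨hper.lift x, hmaps x⟩
  have hg : Function.Bijective g := by
    constructor
    · intro x y hxy
      obtain ⟨a, rfl⟩ := QuotientAddGroup.mk_surjective x
      obtain ⟨b, rfl⟩ := QuotientAddGroup.mk_surjective y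
      obtain ⟨z, hz⟩ := hmul a b (congrArg Subtype.val hxy)
      refine (sub_eq_zero.1 ?_).symm
      exact (AddCircle.coe_eq_zero_iff T).2 ⟨z, (zsmul_eq_mul _ _).trans hz.symm⟩
    · rintro ⟨_, t, -, rfl⟩
      exact ⟨(t : AddCircle T), rfl⟩
  have hgc : Continuous g :=
    (continuous_quot_lift _ hφs.continuous).subtype_mk hmaps
  let e : AddCircle T ≃ₜ φ '' univ :=
    Continuous.homeoOfEquivCompactToT2 (f := Equiv.ofBijective g hg) hgc
  let H : Circle ≃ₜ φ '' univ := (AddCircle.homeomorphCircle hT.ne').symm.trans e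
  have hpi := Real.pi_pos
  have hH : ∀ t : ℝ, (H (Circle.exp t) : Euc n) = φ (T / (2 * Real.pi) * t) := fun t => by
    have h1 : (AddCircle.homeomorphCircle hT.ne').symm (Circle.exp t) =
        ((T / (2 * Real.pi) * t : ℝ) : AddCircle T) := by
      rw [Homeomorph.symm_apply_eq, AddCircle.homeomorphCircle_apply, AddCircle.toCircle_apply_mk]
      congr 1
      field_simp
    change (e ((AddCircle.homeomorphCircle hT.ne').symm (Circle.exp t)) : Euc n) = _
    rw [h1]
    rfl
  refine ⟨H, ?_, fun t => ?_, fun z => ?_⟩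
  · simp only [hH]
    exact hφs.comp (contDiff_const.mul contDiff_id)
  · simp only [hH]
    have h1 := (hφ.hasDerivAt (T / (2 * Real.pi) * t) (mem_univ _)).scomp t
      ((hasDerivAt_id t).const_mul (T / (2 * Real.pi)))
    have h2 : deriv (fun s => φ (T / (2 * Real.pi) * s)) t = _ := h1.deriv
    rw [h2]
    exact smul_ne_zero (by positivity) (h0 _)
  · obtain ⟨t, rfl⟩ := Circle.exp_surjective z
    rw [← Circle.exp_add, hH, hH, hf]
    congr 1
    field_simp
    ring

/-- An injective solution `φ`, open as a map from `I` onto its orbit, composed with a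
parametrization `ρ` of `I` by the line, is a diffeomorphism between the line and the orbit. It
conjugates `f` to a translation as soon as `f` acts as one in the parameter of `ρ`. -/
theorem conjugatedToTranslation_of_injOn (hφ : IsCurve X U I φ) (hX : ContDiffOn ℝ 1 X U)
    (h0 : ∀ t ∈ I, X (φ t) ≠ 0) (hinj : InjOn φ I)
    (hopen : ∀ t ∈ I, ∀ N ∈ 𝓝 t, φ '' N ∈ 𝓝[φ '' I] (φ t)) {ρ : ℝ → ℝ} (hρ : ContDiff ℝ 1 ρ)
    (hρ' : ∀ t, deriv ρ t ≠ 0) (hρi : Function.Injective ρ) (hρI : range ρ = I) {c : ℝ}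
    (hf : ∀ t, f (φ (ρ t)) = φ (ρ (t + c))) : ConjugatedToTranslation f (φ '' I) c := by
  have hmem : ∀ t, ρ t ∈ I := fun t => hρI ▸ mem_range_self t
  have hs : ContDiff ℝ 1 (fun t => φ (ρ t)) :=
    contDiffOn_univ.1 ((hφ.contDiffOn hX).comp hρ.contDiffOn fun t _ => hmem t)
  let g : ℝ → φ '' I := fun t => ⟨φ (ρ t), mem_image_of_mem φ (hmem t)⟩
  have hg : Function.Bijective g := by
    constructor
    · intro a b hab
      exact hρi (hinj (hmem a) (hmem b) (congrArg Subtype.val hab))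
    · rintro ⟨_, t, ht, rfl⟩
      rw [← hρI] at ht
      obtain ⟨s, rfl⟩ := ht
      exact ⟨s, rfl⟩
  have hgo : IsOpenMap g := by
    refine isOpenMap_iff_nhds_le.2 fun t => ?_
    intro A hA
    have hstr : HasStrictDerivAt ρ (deriv ρ t) t := hρ.contDiffAt.hasStrictDerivAt one_ne_zero
    have h1 : ρ '' (g ⁻¹' A) ∈ 𝓝 (ρ t) := by
      rw [← hstr.map_nhds_eq (hρ' t)]
      exact image_mem_map hA
    have h2 := hopen _ (hmem t) _ h1
    rw [← map_nhds_subtype_val (g t)] at h2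
    refine mem_of_superset h2 ?_
    rintro y ⟨_, ⟨s, hsA, rfl⟩, hy⟩
    have : g s = y := Subtype.ext hy
    exact this ▸ hsA
  let H : ℝ ≃ₜ φ '' I := (Equiv.ofBijective g hg).toHomeomorphOfContinuousOpen
    (hs.continuous.subtype_mk _) hgo
  refine ⟨H, hs, fun t => ?_, hf⟩
  have h1 := (hφ.hasDerivAt (ρ t) (hmem t)).scomp t
    (hρ.differentiable one_ne_zero t).hasDerivAt
  have h2 : deriv (fun s => φ (ρ s)) t = _ := h1.deriv
  change deriv (fun s => φ (ρ s)) t ≠ 0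
  rw [h2]
  exact smul_ne_zero (hρ' t) (h0 _ (hmem t))

/-- A map that sends solutions to solutions and preserves the orbit of a maximal solution `φ` acts
on it by a shift of time. When the domain `I` of an injective `φ` is not the whole line, it admits
no nonzero shift, and the map is the identity on the orbit. -/
theorem IsMaximalSolution.translationLike (hφ : IsMaximalSolution X U p I φ) (hU : IsOpen U)
    (hX : ContDiffOn ℝ 1 X U) (h0 : ∀ t ∈ I, X (φ t) ≠ 0)
    (hopen : ∀ t ∈ I, ∀ N ∈ 𝓝 t, φ '' N ∈ 𝓝[φ '' I] (φ t)) (hfφ : IsCurve X U I (f ∘ φ))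
    (hf : f '' (φ '' I) = φ '' I) : TranslationLike f I φ := by
  have h0I := hφ.1.zero_mem
  obtain ⟨τ, hτ, hτf⟩ : f (φ 0) ∈ φ '' I :=
    hf ▸ mem_image_of_mem f (mem_image_of_mem φ h0I)
  have hshift : ∀ t ∈ I, t + τ ∈ I ∧ f (φ t) = φ (t + τ) := fun t ht => by
    have h := hφ.add_mem_and_apply_add hU hX hfφ hτ h0I hτf.symm ht
    rw [sub_zero] at h
    exact ⟨h.1, h.2.symm⟩
  by_cases hinj : InjOn φ I
  · right
    -- By injectivity, that `f` maps the orbit onto itself says that `I` is its own shift by `τ`.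
    have hback : ∀ t ∈ I, t - τ ∈ I := fun t ht => by
      have h1 : φ t ∈ f '' (φ '' I) := by
        rw [hf]
        exact mem_image_of_mem φ ht
      obtain ⟨_, ⟨s, hs, rfl⟩, hst⟩ := h1
      rw [(hshift s hs).2] at hst
      rw [← hinj (hshift s hs).1 ht hst]
      simpa using hs
    by_cases hτ0 : τ = 0
    · obtain ⟨ρ, hρ, hρ', hρi, hρI⟩ :=
        exists_contDiff_range_eq hφ.1.isOpen hφ.1.ordConnected ⟨0, h0I⟩
      refine ⟨0, conjugatedToTranslation_of_injOn hφ.1.isCurve hX h0 hinj hopen hρ hρ' hρi hρI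
        fun t => ?_⟩
      rw [(hshift _ (hρI ▸ mem_range_self t)).2, hτ0, add_zero, add_zero]
    · have huniv : I = univ := hφ.1.ordConnected.eq_univ_of_add_sub_mem h0I hτ0
        (fun u hu => (hshift u hu).1) hback
      refine ⟨τ, conjugatedToTranslation_of_injOn hφ.1.isCurve hX h0 hinj hopen contDiff_id
        (fun t => by simp) Function.injective_id (range_id.trans huniv.symm) fun t => ?_⟩
      exact (hshift t (huniv ▸ mem_univ t)).2
  · left
    obtain ⟨rfl, T, hT, hmul⟩ := hφ.exists_period_of_not_injOn hU hX
      (hφ.1.init ▸ h0 0 h0I) hinj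
    exact ⟨T, τ, rfl, hT, hτf, conjugatedToRotation_of_periodic hφ.1.isCurve hX
      (fun t => h0 t (mem_univ t)) hT.1.1 hT.1.2 hmul fun t => (hshift t (mem_univ t)).2⟩

end Orbit

/-! ### The dynamics on a regular orbit -/

/-- `F` is a diffeomorphism of the open connected set `U ⊆ ℝ^(k+1)`, `k ≥ 1`, with `k` functionally
independent first integrals `V₁, …, V_k`, satisfying condition `μ`. The orbit `φ '' I` of `X_μ`
through `p` is regular: the connected component through `p` of the level set of `V` contains no
critical point of `X_μ` (in particular `X_μ p ≠ 0`). -/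
theorem theorem2 (k : ℕ) (hk : 1 ≤ k) (U : Set (Euc (k + 1)))
    (hUo : IsOpen U) (hUc : IsConnected U)
    (F : Euc (k + 1) → Euc (k + 1)) (hF : IsDiffeoOn F U)
    (V : Fin k → Euc (k + 1) → ℝ) (hVs : ∀ i, ContDiffOn ℝ 2 (V i) U)
    (hV : ∀ i, IsFirstIntegral F U (V i)) (hVi : FunctionallyIndependent V U)
    (μ : Euc (k + 1) → ℝ) (hμs : ContDiffOn ℝ 1 μ U) (hμ : ConditionMu F U μ)
    (p : Euc (k + 1)) (hp : p ∈ U)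
    (I : Set ℝ) (φ : ℝ → Euc (k + 1)) (hφ : IsMaximalSolution (fieldMu V μ) U p I φ)
    (hreg : ∀ x ∈ connectedComponentIn (levelSet U V p) p, fieldMu V μ x ≠ 0)
    (hfin : Finite (ConnectedComponents (levelSet U V p))) :
    ∃ m : ℕ, 1 ≤ m ∧ m ≤ Nat.card (ConnectedComponents (levelSet U V p)) ∧
      F^[m] '' (φ '' I) = φ '' I ∧ TranslationLike F^[m] I φ := by
  obtain ⟨hFU, hFs, -⟩ := id hF
  have hVs1 : ∀ i, ContDiffOn ℝ 1 (V i) U := fun i => (hVs i).of_le one_le_two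
  have hFd : DifferentiableOn ℝ F U := hFs.differentiableOn one_ne_zero
  have hX : ContDiffOn ℝ 1 (fieldMu V μ) U := contDiffOn_fieldMu hUo hVs hμs
  have hVX : ∀ x ∈ U, ∀ i, fderiv ℝ (V i) x (fieldMu V μ x) = 0 :=
    fun x _ i => fderiv_fieldMu_eq_zero i
  have hVker : ∀ x ∈ U, fieldMu V μ x ≠ 0 → ∀ v, (∀ i, fderiv ℝ (V i) x v = 0) →
      inner ℝ (fieldMu V μ x) v = 0 → v = 0 :=
    fun x _ hx v => eq_zero_of_fderiv_eq_zero_of_inner_fieldMu hx v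
  have hFX : ∀ x ∈ U, fderiv ℝ F x (fieldMu V μ x) = fieldMu V μ (F x) := fun x hx =>
    fderiv_apply_fieldMu hUo hFU hFd (fun i => (hVs1 i).differentiableOn one_ne_zero)
      (fun i => (hV i).1) hμ hx
  have hI := hφ.1.isCurve
  have horb := hφ.image_eq_connectedComponentIn hUo hX hVs1 hVX hVker hreg
  have h0 : ∀ t ∈ I, fieldMu V μ (φ t) ≠ 0 := fun t ht =>
    hreg _ (horb ▸ mem_image_of_mem φ ht)
  obtain ⟨m, hm, hmM, hmC⟩ :=
    exists_iterate_image_connectedComponentIn hF (fun i => (hV i).1) hp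
  rw [← horb] at hmC
  refine ⟨m, hm, hmM, hmC, hφ.translationLike hUo hX h0 (fun t ht N hN => ?_)
    (hI.map_iterate hUo hFU hFd hFX m) hmC⟩
  have hsub : φ '' I ⊆ levelSet U V (φ t) := by
    rintro _ ⟨s, hs, rfl⟩
    exact hI.mem_levelSet hUo hVs1 hVX hs ht
  exact nhdsWithin_mono _ hsub
    (hI.image_mem_nhdsWithin_levelSet hUo hX hVs1 hVX hVker ht (h0 t ht) hN)
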